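/- Let $\alpha>1$ be a real number. Every $x\in(0,1]$ has a unique $\alpha$-expansion, that is, a unique sequence $(d_i)_{i\ge 1}$ of positive integers with $$x=\sum_{i=1}^{\infty}(\alpha-1)^{i-1}\alpha^{-(d_1+\dots+d_i)}.$$ Let $n\ge 1$ and let $\mathfrak p=(p_1,\dots,p_n)$ be a probability vector, that is, $p_d\ge 0$ for all $d$ and $\sum_{d=1}^n p_d=1$. Put $$E(\mathfrak p)=\sum_{d=1}^n d\,p_d,\qquad H(\mathfrak p)=-\sum_{d=1}^n p_d\log p_d\quad(\text{with }0\log 0=0).$$ Let $\mathfrak F_\alpha(\mathfrak p)$ be the set of all $x\in(0,1]$ whose $\alpha$-expansion $(d_i)$ satisfies $$\lim_{N\to\infty}\frac{\#\{j\in\{1,\dots,N\}: d_j=d\}}{N}=p_d\qquad\text{for each } d=1,\dots,n.$$ Then $$\dim_H\mathfrak F_\alpha(\mathfrak p)=\frac{H(\mathfrak p)}{E(\mathfrak p)\log\alpha-\log(\alpha-1)},$$ where $\dim_H$ denotes Hausdorff dimension. -/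

import Mathlib

open Filter Topology

noncomputable section

namespace AlphaExpansion

/-- `d` is the `α`-expansion of `x`: the digits `d 0, d 1, d 2, …` are positive integers and
`x = ∑_{i ≥ 1} (α - 1)^(i-1) α^(-(d_1 + ⋯ + d_i))`. The digit written `d_i` on paper, with `i ≥ 1`,
is `d (i - 1)` here. -/
def IsExpansion (α : ℝ) (d : ℕ → ℕ+) (x : ℝ) : Prop :=
  HasSum (fun i : ℕ => (α - 1) ^ i / α ^ (∑ j ∈ Finset.range (i + 1), (d j : ℕ))) x

/-- The number of occurrences of the digit `k` among the first `N` digits of `d`. -/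
def digitCount (d : ℕ → ℕ+) (k N : ℕ) : ℕ :=
  ((Finset.range N).filter (fun j => (d j : ℕ) = k)).card

/-- The asymptotic frequency of the digit `k` in `d` exists and equals `f`. -/
def HasFrequency (d : ℕ → ℕ+) (k : ℕ) (f : ℝ) : Prop :=
  Tendsto (fun N : ℕ => (digitCount d k N : ℝ) / (N : ℝ)) atTop (𝓝 f)

/-- The set of `x ∈ (0, 1]` in whose `α`-expansion each digit `k ∈ {1, …, n}` has frequency `p_k`.
The entry written `p_k` on paper is `p i` for the index `i : Fin n` of value `k - 1`. -/
def frequencySet (α : ℝ) {n : ℕ} (p : Fin n → ℝ) : Set ℝ :=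
  {x | x ∈ Set.Ioc (0 : ℝ) 1 ∧
    ∃ d : ℕ → ℕ+, IsExpansion α d x ∧ ∀ i : Fin n, HasFrequency d ((i : ℕ) + 1) (p i)}

/-- The expected value `∑ k p_k` of a probability vector on `{1, …, n}`. -/
def expectedValue {n : ℕ} (p : Fin n → ℝ) : ℝ :=
  ∑ i : Fin n, ((i : ℕ) + 1 : ℝ) * p i

/-- The entropy `-∑ p_k log p_k` of a probability vector, with `0 log 0 = 0`. -/
def entropy {n : ℕ} (p : Fin n → ℝ) : ℝ :=
  -∑ i : Fin n, p i * Real.log (p i)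

end AlphaExpansion

end

open MeasureTheory
open scoped ENNReal NNReal

/-! ### Geometry of cylinders and averages along digit sequences. -/

namespace AlphaExpansion

noncomputable section

/-! Expansions code the self-similar system whose digit-`k` branch contracts (0, 1] by `ratio α k`
onto (α^(-k), α^(1-k)]. Along a sequence with frequencies `p`, the logarithm of a cylinder's length
averages to -D per digit, where D = E log α - log(α - 1) > 0, and its Bernoulli(`p`) mass has
exponential rate -H. The dimension is the quotient H/D.

Upper bound: for s > H/D, `exists_weight` tilts `ratio α k ^ s` into a subprobability on all
positive digits, with the tilt growing linearly along every admissible sequence. Covering by the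
cylinders of length N then costs at most exp(-ηN) (`hausdorffMeasure_eq_zero`). Digits beyond `n`
may occur with frequency zero, so the alphabet is infinite here.

Lower bound: the Bernoulli measure on sequences over {1, …, n} gives full mass to frequency `p` by
the strong law. For t < H/D, cylinder masses are at most a constant times length^t
(`exists_prod_le`). Bounded digits give separated cylinders (`le_abs_value_sub_value`), so the mass
distribution principle applies to the image measure. -/

/-- The contraction ratio of the branch of the digit `k`. -/
def ratio (α : ℝ) (k : ℕ) : ℝ := (α - 1) / α ^ k

/-- The point with `α`-expansion `d`. -/
def value (α : ℝ) (d : ℕ → ℕ+) : ℝ :=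
  ∑' i : ℕ, (α - 1) ^ i / α ^ (∑ j ∈ Finset.range (i + 1), (d j : ℕ))

lemma ratio_pos {α : ℝ} (hα : 1 < α) (k : ℕ) : 0 < ratio α k :=
  div_pos (by linarith) (by positivity)

lemma ratio_anti {α : ℝ} (hα : 1 < α) {k l : ℕ} (h : k ≤ l) : ratio α l ≤ ratio α k := by
  have : 0 < α - 1 := by linarith
  unfold ratio
  gcongr
  exact hα.le

lemma ratio_one_lt_one {α : ℝ} (hα : 1 < α) : ratio α 1 < 1 := by
  unfold ratio
  rw [div_lt_one (by positivity)]
  simp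

lemma log_ratio {α : ℝ} (hα : 1 < α) (k : ℕ) :
    Real.log (ratio α k) = Real.log (α - 1) - k * Real.log α := by
  unfold ratio
  rw [Real.log_div (by linarith) (by positivity), Real.log_pow]

lemma le_sum_digits (d : ℕ → ℕ+) (i : ℕ) : i ≤ ∑ j ∈ Finset.range i, (d j : ℕ) := by
  calc i = ∑ j ∈ Finset.range i, 1 := by simp
    _ ≤ _ := Finset.sum_le_sum fun j _ => (d j).pos

/-- The bound is attained by the constant digit 1, whose series is geometric with sum 1. -/
lemma term_le {α : ℝ} (hα : 1 < α) (d : ℕ → ℕ+) (i : ℕ) :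
    (α - 1) ^ i / α ^ (∑ j ∈ Finset.range (i + 1), (d j : ℕ)) ≤ ratio α 1 ^ i * α⁻¹ := by
  have h0 : 0 < α - 1 := by linarith
  calc (α - 1) ^ i / α ^ (∑ j ∈ Finset.range (i + 1), (d j : ℕ))
      ≤ (α - 1) ^ i / α ^ (i + 1) := by
        gcongr
        · exact hα.le
        · exact le_sum_digits d (i + 1)
    _ = _ := by
        unfold ratio
        rw [div_pow, pow_succ]
        field_simp

lemma hasSum_geometric_ratio {α : ℝ} (hα : 1 < α) :
    HasSum (fun i : ℕ => ratio α 1 ^ i * α⁻¹) 1 := by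
  have h := (hasSum_geometric_of_lt_one (ratio_pos hα 1).le (ratio_one_lt_one hα)).mul_right α⁻¹
  have h1 : (1 - ratio α 1)⁻¹ * α⁻¹ = 1 := by
    unfold ratio
    field_simp
    simp
  rwa [h1] at h

lemma isExpansion_value {α : ℝ} (hα : 1 < α) (d : ℕ → ℕ+) : IsExpansion α d (value α d) := by
  have h0 : 0 < α - 1 := by linarith
  exact (Summable.of_nonneg_of_le (fun i => by positivity) (term_le hα d)
    (hasSum_geometric_ratio hα).summable).hasSum

lemma IsExpansion.eq_value {α : ℝ} {d : ℕ → ℕ+} {x : ℝ} (h : IsExpansion α d x) :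
    x = value α d := h.tsum_eq.symm

lemma value_le_one {α : ℝ} (hα : 1 < α) (d : ℕ → ℕ+) : value α d ≤ 1 :=
  hasSum_le (term_le hα d) (isExpansion_value hα d) (hasSum_geometric_ratio hα)

lemma value_eq {α : ℝ} (hα : 1 < α) (d : ℕ → ℕ+) :
    value α d = 1 / α ^ (d 0 : ℕ) + ratio α (d 0) * value α (fun j => d (j + 1)) := by
  rw [value, (isExpansion_value hα d).summable.tsum_eq_zero_add, value, ← tsum_mul_left]
  have h1 : ∀ i : ℕ, (α - 1) ^ (i + 1) / α ^ (∑ j ∈ Finset.range (i + 1 + 1), (d j : ℕ)) =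
      ratio α (d 0) * ((α - 1) ^ i / α ^ (∑ j ∈ Finset.range (i + 1), (d (j + 1) : ℕ))) := by
    intro i
    rw [Finset.sum_range_succ' _ (i + 1), pow_succ, pow_add, ratio]
    field_simp
  simp [h1]

lemma value_pos {α : ℝ} (hα : 1 < α) (d : ℕ → ℕ+) : 0 < value α d := by
  have h0 : 0 < α - 1 := by linarith
  exact (isExpansion_value hα d).summable.tsum_pos (fun i => by positivity) 0 (by positivity)

lemma one_div_pow_le_value {α : ℝ} (hα : 1 < α) (d : ℕ → ℕ+) :
    1 / α ^ (d 0 : ℕ) ≤ value α d := by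
  rw [value_eq hα d]
  have := mul_pos (ratio_pos hα (d 0)) (value_pos hα fun j => d (j + 1))
  linarith

lemma value_le_one_div_pow {α : ℝ} (hα : 1 < α) (d : ℕ → ℕ+) :
    value α d ≤ α / α ^ (d 0 : ℕ) := by
  rw [value_eq hα d]
  have h1 := value_le_one hα fun j => d (j + 1)
  have := mul_le_mul_of_nonneg_left h1 (ratio_pos hα (d 0)).le
  have h2 : α / α ^ (d 0 : ℕ) = 1 / α ^ (d 0 : ℕ) + ratio α (d 0) := by unfold ratio; ring
  linarith

/-- Points whose expansions share a prefix differ by the product of the ratios of that prefix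
times the difference of the points coded by the tails. -/
lemma value_sub_value {α : ℝ} (hα : 1 < α) (N : ℕ) (d e : ℕ → ℕ+) (h : ∀ j < N, d j = e j) :
    value α d - value α e = (∏ j ∈ Finset.range N, ratio α (d j)) *
      (value α (fun j => d (j + N)) - value α (fun j => e (j + N))) := by
  induction N generalizing d e with
  | zero => simp
  | succ N ih =>
    rw [value_eq hα d, value_eq hα e, ← h 0 (by omega), Finset.prod_range_succ',
      add_sub_add_left_eq_sub, ← mul_sub,
      ih (fun j => d (j + 1)) (fun j => e (j + 1)) fun j hj => h (j + 1) (by omega)]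
    simp only [add_assoc, add_comm N 1]
    ring

lemma prod_ratio_pos {α : ℝ} (hα : 1 < α) (N : ℕ) (d : ℕ → ℕ+) :
    0 < ∏ j ∈ Finset.range N, ratio α (d j) :=
  Finset.prod_pos fun _ _ => ratio_pos hα _

lemma prod_ratio_le {α : ℝ} (hα : 1 < α) (N : ℕ) (d : ℕ → ℕ+) :
    ∏ j ∈ Finset.range N, ratio α (d j) ≤ ratio α 1 ^ N := by
  calc _ ≤ ∏ j ∈ Finset.range N, ratio α 1 :=
        Finset.prod_le_prod (fun _ _ => (ratio_pos hα _).le) fun j _ => ratio_anti hα (d j).pos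
    _ = _ := by simp

lemma abs_value_sub_value_le {α : ℝ} (hα : 1 < α) (N : ℕ) (d e : ℕ → ℕ+)
    (h : ∀ j < N, d j = e j) :
    |value α d - value α e| ≤ ∏ j ∈ Finset.range N, ratio α (d j) := by
  rw [value_sub_value hα N d e h, abs_mul, abs_of_pos (prod_ratio_pos hα N d)]
  refine mul_le_of_le_one_right (prod_ratio_pos hα N d).le ?_
  rw [abs_le]
  have h1 := value_pos hα fun j => d (j + N)
  have h2 := value_pos hα fun j => e (j + N)
  have h3 := value_le_one hα fun j => d (j + N)
  have h4 := value_le_one hα fun j => e (j + N)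
  constructor <;> linarith

/-- The first digits place the two points on either side of α^(-d 0). The second digit of `d`, being
at most `n`, keeps the tail of `d` at least α^(-n) away from 0, which leaves a uniform gap. -/
lemma value_sub_value_of_lt {α : ℝ} (hα : 1 < α) {n : ℕ} (d e : ℕ → ℕ+)
    (hd : ∀ j, (d j : ℕ) ≤ n) (h : d 0 < e 0) :
    ratio α n / α ^ n ≤ value α d - value α e := by
  have h0 : 0 < α - 1 := by linarith
  have h1 : value α e ≤ 1 / α ^ (d 0 : ℕ) := by
    refine (value_le_one_div_pow hα e).trans ?_
    rw [div_le_div_iff₀ (by positivity) (by positivity), one_mul, ← pow_succ']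
    exact pow_le_pow_right₀ hα.le h
  rw [value_eq hα d]
  have h2 : ratio α n ≤ ratio α (d 0) := ratio_anti hα (hd 0)
  have h3 : 1 / α ^ n ≤ value α (fun j => d (j + 1)) := by
    refine le_trans ?_ (one_div_pow_le_value hα _)
    gcongr
    · exact hα.le
    · exact hd 1
  have h4 : ratio α n * (1 / α ^ n) ≤ ratio α (d 0) * value α (fun j => d (j + 1)) :=
    mul_le_mul h2 h3 (by positivity) (ratio_pos hα _).le
  rw [div_eq_mul_one_div]
  linarith

/-- Strong separation for expansions with bounded digits. -/
lemma le_abs_value_sub_value {α : ℝ} (hα : 1 < α) {n : ℕ} (N : ℕ) (d e : ℕ → ℕ+)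
    (hd : ∀ j, (d j : ℕ) ≤ n) (he : ∀ j, (e j : ℕ) ≤ n)
    (h : ∀ j < N, d j = e j) (hN : d N ≠ e N) :
    ratio α n / α ^ n * ∏ j ∈ Finset.range N, ratio α (d j) ≤ |value α d - value α e| := by
  rw [value_sub_value hα N d e h, abs_mul, abs_of_pos (prod_ratio_pos hα N d), mul_comm]
  refine mul_le_mul_of_nonneg_left ?_ (prod_ratio_pos hα N d).le
  rcases lt_or_gt_of_ne hN with hlt | hlt
  · exact (value_sub_value_of_lt hα (fun j => d (j + N)) (fun j => e (j + N))
      (fun j => hd _) (by simpa using hlt)).trans (le_abs_self _)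
  · rw [abs_sub_comm]
    exact (value_sub_value_of_lt hα (fun j => e (j + N)) (fun j => d (j + N))
      (fun j => he _) (by simpa using hlt)).trans (le_abs_self _)

/-- The function on digits that is `g` on `{1, …, n}` and `τ` beyond. -/
def extendDigits {n : ℕ} (g : Fin n → ℝ) (τ : ℝ) (k : ℕ) : ℝ :=
  τ + ∑ i : Fin n, if k = (i : ℕ) + 1 then g i - τ else 0

lemma extendDigits_succ {n : ℕ} (g : Fin n → ℝ) (τ : ℝ) (i : Fin n) :
    extendDigits g τ ((i : ℕ) + 1) = g i := by
  unfold extendDigits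
  rw [Finset.sum_eq_single i]
  · simp
  · intro j _ hj
    rw [if_neg]
    intro h
    exact hj (Fin.ext (by omega))
  · simp

lemma extendDigits_of_ne {n : ℕ} (g : Fin n → ℝ) (τ : ℝ) {k : ℕ}
    (h : ∀ i : Fin n, k ≠ (i : ℕ) + 1) : extendDigits g τ k = τ := by
  simp [extendDigits, h]

/-- Only the counts of the digits 1, …, n enter, so no frequency of a larger digit is needed. -/
lemma sum_extendDigits {n : ℕ} (g : Fin n → ℝ) (τ : ℝ) (d : ℕ → ℕ+) (N : ℕ) :
    ∑ j ∈ Finset.range N, extendDigits g τ (d j) =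
      N * τ + ∑ i : Fin n, (g i - τ) * digitCount d ((i : ℕ) + 1) N := by
  unfold extendDigits
  rw [Finset.sum_add_distrib, Finset.sum_comm]
  simp [digitCount, Finset.sum_ite, mul_comm, sub_mul]

/-- Averages along a digit sequence with prescribed frequencies. -/
lemma tendsto_average {n : ℕ} {p : Fin n → ℝ} (hp : ∑ i, p i = 1) {d : ℕ → ℕ+}
    (hd : ∀ i : Fin n, HasFrequency d ((i : ℕ) + 1) (p i)) (g : Fin n → ℝ) (τ : ℝ) :
    Tendsto (fun N : ℕ => (∑ j ∈ Finset.range N, extendDigits g τ (d j)) / N) atTop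
      (𝓝 (∑ i, p i * g i)) := by
  have h1 : Tendsto (fun N : ℕ => τ + ∑ i : Fin n,
      (g i - τ) * ((digitCount d ((i : ℕ) + 1) N : ℝ) / N)) atTop
      (𝓝 (τ + ∑ i, (g i - τ) * p i)) :=
    tendsto_const_nhds.add (tendsto_finsetSum _ fun i _ => (hd i).const_mul _)
  -- Total mass one cancels `τ`: the digits beyond `n` have joint frequency zero.
  have h2 : τ + ∑ i, (g i - τ) * p i = ∑ i, p i * g i := by
    simp only [sub_mul, Finset.sum_sub_distrib, ← Finset.mul_sum, hp]
    simp [mul_comm]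
  rw [h2] at h1
  refine h1.congr' ?_
  filter_upwards [eventually_gt_atTop 0] with N hN
  have : (N : ℝ) ≠ 0 := by positivity
  rw [sum_extendDigits, add_div, Finset.sum_div]
  congr 1
  · field_simp
  · exact Finset.sum_congr rfl fun i _ => by ring

end

end AlphaExpansion

/-! ### Upper bound by covering with cylinders. -/

namespace AlphaExpansion

noncomputable section

lemma tsum_fin_prod {ι : Type*} (f : ι → ℝ≥0∞) (N : ℕ) :
    ∑' w : Fin N → ι, ∏ j, f (w j) = (∑' k, f k) ^ N := by
  induction N with
  | zero => simp
  | succ N ih =>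
    rw [← (Fin.consEquiv fun _ : Fin (N + 1) => ι).tsum_eq, ENNReal.tsum_prod', pow_succ',
      ← ih, ← ENNReal.tsum_mul_right]
    refine tsum_congr fun k => ?_
    rw [← ENNReal.tsum_mul_left]
    refine tsum_congr fun w => ?_
    simp [Fin.consEquiv, Fin.prod_univ_succ]

lemma summable_ratio_rpow {α : ℝ} (hα : 1 < α) {s : ℝ} (hs : 0 < s) :
    Summable fun k : ℕ+ => ratio α k ^ s := by
  have h1 : 1 < α ^ s := Real.one_lt_rpow hα hs
  have h2 : Summable fun k : ℕ => (α - 1) ^ s * ((α ^ s)⁻¹) ^ k :=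
    (summable_geometric_of_lt_one (by positivity) (inv_lt_one_of_one_lt₀ h1)).mul_left _
  refine (h2.comp_injective PNat.coe_injective).congr fun k => ?_
  simp only [Function.comp, ratio]
  rw [Real.div_rpow (by linarith) (by positivity), inv_pow, ← Real.rpow_natCast,
    ← Real.rpow_natCast, ← Real.rpow_mul (by linarith), ← Real.rpow_mul (by linarith),
    mul_comm s, div_eq_mul_inv]

lemma sum_mul_log_ratio {α : ℝ} (hα : 1 < α) {n : ℕ} {p : Fin n → ℝ} (hp : ∑ i, p i = 1) :
    ∑ i : Fin n, p i * Real.log (ratio α ((i : ℕ) + 1)) =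
      -(expectedValue p * Real.log α - Real.log (α - 1)) := by
  simp only [log_ratio hα, mul_sub, Finset.sum_sub_distrib, ← Finset.sum_mul, hp, expectedValue]
  rw [Finset.sum_mul]
  have : ∀ i : Fin n, p i * (((i : ℕ) + 1 : ℕ) * Real.log α) =
      ((i : ℕ) + 1 : ℝ) * p i * Real.log α := fun i => by push_cast; ring
  simp only [this]
  ring

/-- Digit weights that turn the sum over all words of a given length into at most one while
growing along sequences with frequencies `p`. -/
lemma exists_weight {α : ℝ} (hα : 1 < α) {n : ℕ} {p : Fin n → ℝ} (hp0 : ∀ i, 0 ≤ p i)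
    (hp : ∑ i, p i = 1) {s : ℝ} (hs : 0 < s)
    (h : entropy p < s * (expectedValue p * Real.log α - Real.log (α - 1))) :
    ∃ (g : Fin n → ℝ) (τ : ℝ), 0 < ∑ i, p i * g i ∧
      ∑' k : ℕ+, ENNReal.ofReal (ratio α k ^ s * Real.exp (extendDigits g τ k)) ≤ 1 := by
  set D := expectedValue p * Real.log α - Real.log (α - 1) with hD
  -- `θ` is added to each of the `n` entries of `p`, making all of them positive, and once more for
  -- the digits beyond `n`. Normalising by `Z` then costs log Z ≤ (n + 1)θ, less than the available
  -- slack.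
  obtain ⟨θ, hθ, hθ'⟩ : ∃ θ : ℝ, 0 < θ ∧ (n + 1) * θ < s * D - entropy p := by
    refine ⟨(s * D - entropy p) / (n + 2), div_pos (by linarith) (by positivity), ?_⟩
    rw [← mul_div_assoc, div_lt_iff₀ (by positivity)]
    nlinarith
  set Z : ℝ := 1 + (n + 1) * θ with hZ
  have hZ0 : 0 < Z := by positivity
  have hS := summable_ratio_rpow hα hs
  set S := ∑' k : ℕ+, ratio α k ^ s with hSdef
  have hS0 : 0 ≤ S := tsum_nonneg fun k => Real.rpow_nonneg (ratio_pos hα _).le _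
  have hq : ∀ i, 0 < (p i + θ) / Z := fun i => div_pos (by linarith [hp0 i]) hZ0
  have hτ : 0 < θ / Z / (S + 1) := by positivity
  -- These weights turn `ratio α k ^ s` into (p_k + θ)/Z for k ≤ n, and into the fixed multiple
  -- θ/(Z(S + 1)) of itself beyond `n`, of total at most θ/Z.
  refine ⟨fun i => Real.log ((p i + θ) / Z) - s * Real.log (ratio α ((i : ℕ) + 1)),
    Real.log (θ / Z / (S + 1)), ?_, ?_⟩
  · have h1 : ∑ i, p i * (Real.log ((p i + θ) / Z) - s * Real.log (ratio α ((i : ℕ) + 1))) =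
        ∑ i, p i * Real.log (p i + θ) - Real.log Z + s * D := by
      have : ∀ i, p i * (Real.log ((p i + θ) / Z) - s * Real.log (ratio α ((i : ℕ) + 1))) =
          p i * Real.log (p i + θ) - p i * Real.log Z -
            s * (p i * Real.log (ratio α ((i : ℕ) + 1))) := fun i => by
        rw [Real.log_div (by linarith [hp0 i]) hZ0.ne']
        ring
      simp only [this, Finset.sum_sub_distrib, ← Finset.sum_mul, ← Finset.mul_sum, hp,
        sum_mul_log_ratio hα hp, ← hD]
      ring
    have h2 : -entropy p ≤ ∑ i, p i * Real.log (p i + θ) := by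
      rw [entropy, neg_neg]
      refine Finset.sum_le_sum fun i _ => ?_
      rcases (hp0 i).eq_or_lt with h0 | h0
      · simp [← h0]
      · exact mul_le_mul_of_nonneg_left (Real.log_le_log h0 (by linarith)) h0.le
    have h3 := Real.log_le_sub_one_of_pos hZ0
    rw [h1]
    linarith
  -- A majorant that is easy to sum: the tail term is granted to the digits up to `n` as well.
  · have hV : HasSum (fun k : ℕ+ => ∑ i : Fin n,
        (if k = Nat.succPNat i then (p i + θ) / Z else 0) +
          ratio α k ^ s * (θ / Z / (S + 1)))
        (∑ i : Fin n, (p i + θ) / Z + S * (θ / Z / (S + 1))) :=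
      (hasSum_sum fun i _ => hasSum_ite_eq _ _).add (hS.hasSum.mul_right _)
    have hV1 : ∑ i : Fin n, (p i + θ) / Z + S * (θ / Z / (S + 1)) ≤ 1 := by
      have h1 : ∑ i : Fin n, (p i + θ) / Z = (1 + n * θ) / Z := by
        rw [← Finset.sum_div, Finset.sum_add_distrib, hp]
        simp
      have h2 : S * (θ / Z / (S + 1)) ≤ θ / Z := by
        rw [← mul_div_assoc, div_le_iff₀ (by positivity)]
        have : 0 < θ / Z := by positivity
        nlinarith
      have h3 : (1 + n * θ) / Z + θ / Z = 1 := by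
        rw [← add_div, div_eq_one_iff_eq hZ0.ne', hZ]
        ring
      linarith
    have hV0 : ∀ k : ℕ+, 0 ≤ ∑ i : Fin n,
        (if k = Nat.succPNat i then (p i + θ) / Z else 0) := fun k =>
      Finset.sum_nonneg fun i _ => by
        split_ifs
        exacts [(hq i).le, le_rfl]
    have hr0 : ∀ k : ℕ+, 0 ≤ ratio α k ^ s * (θ / Z / (S + 1)) := fun k =>
      mul_nonneg (Real.rpow_nonneg (ratio_pos hα _).le _) hτ.le
    calc _ ≤ ∑' k : ℕ+, ENNReal.ofReal (∑ i : Fin n,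
          (if k = Nat.succPNat i then (p i + θ) / Z else 0) +
            ratio α k ^ s * (θ / Z / (S + 1))) := by
          refine ENNReal.tsum_le_tsum fun k => ENNReal.ofReal_le_ofReal ?_
          by_cases hk : ∃ i : Fin n, (k : ℕ) = (i : ℕ) + 1
          · obtain ⟨i, hi⟩ := hk
            have h1 : (p i + θ) / Z ≤ ∑ i : Fin n,
                (if k = Nat.succPNat i then (p i + θ) / Z else 0) := by
              refine le_trans ?_ (Finset.single_le_sum (fun j _ => ?_) (Finset.mem_univ i))
              · rw [if_pos (PNat.eq hi)]
              · split_ifs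
                exacts [(hq j).le, le_rfl]
            have h2 : ratio α k ^ s * Real.exp (extendDigits (fun i : Fin n =>
                Real.log ((p i + θ) / Z) - s * Real.log (ratio α ((i : ℕ) + 1)))
                (Real.log (θ / Z / (S + 1))) k) = (p i + θ) / Z := by
              rw [hi, extendDigits_succ, Real.exp_sub, Real.exp_log (hq i), mul_comm s,
                ← Real.rpow_def_of_pos (ratio_pos hα _)]
              exact mul_div_cancel₀ _ (Real.rpow_pos_of_pos (ratio_pos hα _) _).ne'
            rw [h2]
            exact h1.trans (le_add_of_nonneg_right (hr0 k))
          · push Not at hk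
            rw [extendDigits_of_ne _ _ hk, Real.exp_log hτ]
            exact le_add_of_nonneg_left (hV0 k)
      _ = ENNReal.ofReal (∑' k : ℕ+, (∑ i : Fin n,
          (if k = Nat.succPNat i then (p i + θ) / Z else 0) +
            ratio α k ^ s * (θ / Z / (S + 1)))) :=
          (ENNReal.ofReal_tsum_of_nonneg (fun k => add_nonneg (hV0 k) (hr0 k)) hV.summable).symm
      _ ≤ 1 := by
          rw [hV.tsum_eq]
          exact ENNReal.ofReal_le_one.2 hV1

/-- Points in a cylinder whose digit weights are large: the covering sets. -/
lemma ediam_cylinder_rpow_le {α : ℝ} (hα : 1 < α) {s : ℝ} (hs : 0 < s) (f : ℕ → ℝ) (η : ℝ)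
    {N : ℕ} (w : Fin N → ℕ+) :
    Metric.ediam {x | ∃ d : ℕ → ℕ+, IsExpansion α d x ∧ (∀ j : Fin N, d j = w j) ∧
      η * N ≤ ∑ j ∈ Finset.range N, f (d j)} ^ s ≤
    ENNReal.ofReal (Real.exp (-η) ^ N) *
      ∏ j, ENNReal.ofReal (ratio α (w j) ^ s * Real.exp (f (w j))) := by
  set A := {x | ∃ d : ℕ → ℕ+, IsExpansion α d x ∧ (∀ j : Fin N, d j = w j) ∧
      η * N ≤ ∑ j ∈ Finset.range N, f (d j)}
  rcases A.eq_empty_or_nonempty with hA | ⟨x, d, hx, hdw, hd⟩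
  · simp [hA, hs]
  have hpos : ∀ j, 0 < ratio α (w j) := fun j => ratio_pos hα _
  have h1 : Metric.ediam A ≤ ENNReal.ofReal (∏ j, ratio α (w j)) := by
    refine Metric.ediam_le ?_
    rintro y ⟨e, hy, hew, -⟩ z ⟨e', hz, hew', -⟩
    rw [edist_dist, Real.dist_eq, hy.eq_value, hz.eq_value]
    refine ENNReal.ofReal_le_ofReal ((abs_value_sub_value_le hα N e e' fun j hj => ?_).trans ?_)
    · exact (hew ⟨j, hj⟩).trans (hew' ⟨j, hj⟩).symm
    · rw [Finset.prod_range]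
      simp [hew]
  have h2 : ∑ j, f (w j) = ∑ j ∈ Finset.range N, f (d j) := by
    rw [Finset.sum_range]
    simp [hdw]
  calc Metric.ediam A ^ s ≤ ENNReal.ofReal (∏ j, ratio α (w j)) ^ s :=
        ENNReal.rpow_le_rpow h1 hs.le
    _ = ENNReal.ofReal (∏ j, ratio α (w j) ^ s) := by
        rw [ENNReal.ofReal_rpow_of_pos (Finset.prod_pos fun j _ => hpos j),
          Real.finsetProd_rpow _ _ fun j _ => (hpos j).le]
    _ ≤ ENNReal.ofReal (Real.exp (-η) ^ N * ∏ j, (ratio α (w j) ^ s * Real.exp (f (w j)))) := by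
        refine ENNReal.ofReal_le_ofReal ?_
        rw [Finset.prod_mul_distrib, ← Real.exp_sum, h2, mul_left_comm, ← Real.exp_nat_mul,
          ← Real.exp_add]
        -- The extra factor exp(∑ f - ηN) is at least 1 because the cylinder contains a point whose
        -- weight is large.
        refine le_mul_of_one_le_right
          (Finset.prod_nonneg fun j _ => Real.rpow_nonneg (hpos j).le _) ?_
        rw [Real.one_le_exp_iff]
        linarith
    _ = _ := by
        rw [ENNReal.ofReal_mul (by positivity), ENNReal.ofReal_prod_of_nonneg]
        exact fun j _ => mul_nonneg (Real.rpow_nonneg (hpos j).le _) (Real.exp_pos _).le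

/-- For every N ≥ M the cylinders of length N cover the set. The sum over words factors as the N-th
power of a sum at most 1, leaving exp(-ηN). -/
lemma hausdorffMeasure_eq_zero {α : ℝ} (hα : 1 < α) {s : ℝ} (hs : 0 < s) (f : ℕ → ℝ)
    (hf : ∑' k : ℕ+, ENNReal.ofReal (ratio α k ^ s * Real.exp (f k)) ≤ 1) {η : ℝ} (hη : 0 < η)
    (M : ℕ) :
    μH[s] {x : ℝ | ∃ d : ℕ → ℕ+, IsExpansion α d x ∧
      ∀ N ≥ M, η * N ≤ ∑ j ∈ Finset.range N, f (d j)} = 0 := by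
  have hr1 : Tendsto (fun N : ℕ => ENNReal.ofReal (ratio α 1 ^ N)) atTop (𝓝 0) := by
    simpa using ENNReal.tendsto_ofReal
      (tendsto_pow_atTop_nhds_zero_of_lt_one (ratio_pos hα 1).le (ratio_one_lt_one hα))
  have he : Tendsto (fun N : ℕ => ENNReal.ofReal (Real.exp (-η) ^ N)) atTop (𝓝 0) := by
    simpa using ENNReal.tendsto_ofReal (tendsto_pow_atTop_nhds_zero_of_lt_one
      (Real.exp_pos (-η)).le (Real.exp_lt_one_iff.2 (by linarith)))
  refine le_antisymm ?_ zero_le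
  refine (Measure.hausdorffMeasure_le_liminf_tsum (ι := fun N : ℕ => Fin N → ℕ+) s _ _ hr1
    (fun N w => {x | ∃ d : ℕ → ℕ+, IsExpansion α d x ∧ (∀ j : Fin N, d j = w j) ∧
      η * N ≤ ∑ j ∈ Finset.range N, f (d j)}) ?_ ?_).trans ?_
  · refine Eventually.of_forall fun N w => Metric.ediam_le ?_
    rintro y ⟨e, hy, hew, -⟩ z ⟨e', hz, hew', -⟩
    rw [edist_dist, Real.dist_eq, hy.eq_value, hz.eq_value]
    refine ENNReal.ofReal_le_ofReal ((abs_value_sub_value_le hα N e e' fun j hj => ?_).trans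
      (prod_ratio_le hα N e))
    exact (hew ⟨j, hj⟩).trans (hew' ⟨j, hj⟩).symm
  · filter_upwards [eventually_ge_atTop M] with N hN
    rintro x ⟨d, hx, hd⟩
    exact Set.mem_iUnion.2 ⟨fun j => d j, d, hx, fun _ => rfl, hd N hN⟩
  · rw [← he.liminf_eq]
    refine liminf_le_liminf (Eventually.of_forall fun N => ?_)
    calc _ ≤ ∑' w : Fin N → ℕ+, ENNReal.ofReal (Real.exp (-η) ^ N) *
          ∏ j, ENNReal.ofReal (ratio α (w j) ^ s * Real.exp (f (w j))) :=
          ENNReal.tsum_le_tsum fun w => ediam_cylinder_rpow_le hα hs f η w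
      _ = ENNReal.ofReal (Real.exp (-η) ^ N) *
          (∑' k : ℕ+, ENNReal.ofReal (ratio α k ^ s * Real.exp (f k))) ^ N := by
          rw [ENNReal.tsum_mul_left,
            tsum_fin_prod fun k : ℕ+ => ENNReal.ofReal (ratio α k ^ s * Real.exp (f k))]
      _ ≤ ENNReal.ofReal (Real.exp (-η) ^ N) * 1 := by
          gcongr
          exact pow_le_one₀ zero_le hf
      _ = _ := mul_one _

lemma entropy_nonneg {n : ℕ} {p : Fin n → ℝ} (hp0 : ∀ i, 0 ≤ p i) (hp : ∑ i, p i = 1) :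
    0 ≤ entropy p := by
  rw [entropy, ← Finset.sum_neg_distrib]
  refine Finset.sum_nonneg fun i _ => ?_
  have h1 : p i ≤ 1 := hp ▸ Finset.single_le_sum (fun j _ => hp0 j) (Finset.mem_univ i)
  have := mul_nonneg (hp0 i) (neg_nonneg.2 (Real.log_nonpos (hp0 i) h1))
  linarith

/-- The Lyapunov exponent of a probability vector is positive. -/
lemma lyapunov_pos {α : ℝ} (hα : 1 < α) {n : ℕ} {p : Fin n → ℝ} (hp0 : ∀ i, 0 ≤ p i)
    (hp : ∑ i, p i = 1) : 0 < expectedValue p * Real.log α - Real.log (α - 1) := by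
  have h1 : 1 ≤ expectedValue p := by
    rw [← hp, expectedValue]
    exact Finset.sum_le_sum fun i _ => le_mul_of_one_le_left (hp0 i) (by simp)
  have h2 := Real.log_pos hα
  have h3 : Real.log (α - 1) < Real.log α := Real.log_lt_log (by linarith) (by linarith)
  nlinarith

lemma dimH_frequencySet_le {α : ℝ} (hα : 1 < α) {n : ℕ} {p : Fin n → ℝ} (hp0 : ∀ i, 0 ≤ p i)
    (hp : ∑ i, p i = 1) :
    dimH (frequencySet α p) ≤ ENNReal.ofReal
      (entropy p / (expectedValue p * Real.log α - Real.log (α - 1))) := by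
  have hL := lyapunov_pos hα hp0 hp
  refine dimH_le fun s hs => ?_
  by_contra! hlt
  have hlt' : entropy p / (expectedValue p * Real.log α - Real.log (α - 1)) < s := by
    rw [← ENNReal.ofReal_coe_nnreal] at hlt
    exact (ENNReal.ofReal_lt_ofReal_iff_of_nonneg
      (div_nonneg (entropy_nonneg hp0 hp) hL.le)).1 hlt
  have hs0 : (0 : ℝ) < s := (div_nonneg (entropy_nonneg hp0 hp) hL.le).trans_lt hlt'
  rw [div_lt_iff₀ hL] at hlt'
  obtain ⟨g, τ, hg, hsum⟩ := exists_weight hα hp0 hp hs0 hlt'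
  -- The positive average makes the weights eventually exceed half the limit. The time `M` from
  -- which this holds depends on the point, hence the countable union.
  have hsub : frequencySet α p ⊆ ⋃ M : ℕ, {x : ℝ | ∃ d : ℕ → ℕ+, IsExpansion α d x ∧
      ∀ N ≥ M, (∑ i, p i * g i) / 2 * N ≤ ∑ j ∈ Finset.range N, extendDigits g τ (d j)} := by
    rintro x ⟨-, d, hx, hd⟩
    obtain ⟨M, hM⟩ := eventually_atTop.1
      (((tendsto_average hp hd g τ).eventually (lt_mem_nhds (half_lt_self hg))).and
        (eventually_gt_atTop 0))
    refine Set.mem_iUnion.2 ⟨M, d, hx, fun N hN => ?_⟩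
    obtain ⟨h1, h2⟩ := hM N hN
    rw [lt_div_iff₀ (by positivity)] at h1
    exact h1.le
  have h0 : μH[s] (frequencySet α p) = 0 := measure_mono_null hsub
    (measure_iUnion_null fun M => hausdorffMeasure_eq_zero hα hs0 _ hsum (half_pos hg) M)
  rw [h0] at hs
  exact ENNReal.zero_ne_top hs

end

end AlphaExpansion

open ProbabilityTheory
-- Lower bound by a Bernoulli measure.
namespace AlphaExpansion

noncomputable section

/-- The digit sequence in `{1, …, n}` coded by `ω`. -/
def digitsOf {n : ℕ} (ω : ℕ → Fin n) (j : ℕ) : ℕ+ := Nat.succPNat (ω j)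

lemma coe_digitsOf {n : ℕ} (ω : ℕ → Fin n) (j : ℕ) : (digitsOf ω j : ℕ) = (ω j : ℕ) + 1 := rfl

lemma digitsOf_le {n : ℕ} (ω : ℕ → Fin n) (j : ℕ) : (digitsOf ω j : ℕ) ≤ n := (ω j).isLt

lemma digitsOf_ne {n : ℕ} {ω ω' : ℕ → Fin n} {j : ℕ} (h : ω j ≠ ω' j) :
    digitsOf ω j ≠ digitsOf ω' j := fun h' => h <| Fin.ext <| by
  have := congrArg PNat.val h'
  simpa [digitsOf] using this

lemma measurable_value_digitsOf {α : ℝ} (hα : 1 < α) (n : ℕ) :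
    Measurable fun ω : ℕ → Fin n => value α (digitsOf ω) := by
  have hm : ∀ j : ℕ, Measurable fun ω : ℕ → Fin n => (digitsOf ω j : ℕ) := fun j =>
    (Measurable.of_discrete (f := fun i : Fin n => (i : ℕ) + 1)).comp (measurable_pi_apply j)
  refine measurable_of_tendsto_metrizable (f := fun N (ω : ℕ → Fin n) => ∑ i ∈ Finset.range N,
    (α - 1) ^ i / α ^ (∑ j ∈ Finset.range (i + 1), (digitsOf ω j : ℕ))) (fun N => ?_) ?_
  · refine Finset.measurable_fun_sum _ fun i _ => ?_
    exact (Measurable.of_discrete (f := fun k : ℕ => (α - 1) ^ i / α ^ k)).comp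
      (Finset.measurable_fun_sum _ fun j _ => hm j)
  · exact tendsto_pi_nhds.2 fun ω => (isExpansion_value hα (digitsOf ω)).tendsto_sum_nat

/-- The strong law of large numbers for digit frequencies. -/
lemma ae_hasFrequency {n : ℕ} {p : Fin n → ℝ} (hp0 : ∀ i, 0 ≤ p i) (ν : Measure (Fin n))
    [IsProbabilityMeasure ν] (hν : ∀ i, ν {i} = ENNReal.ofReal (p i)) :
    ∀ᵐ ω ∂(Measure.infinitePi fun _ : ℕ => ν),
      ∀ i : Fin n, HasFrequency (digitsOf ω) ((i : ℕ) + 1) (p i) := by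
  rw [ae_all_iff]
  intro i
  -- The frequency of a digit is the empirical mean of its indicator.
  set φ : Fin n → ℝ := Set.indicator {i} 1 with hφ
  have hφm : Measurable φ := Measurable.of_discrete
  have hev : ∀ j : ℕ, MeasurePreserving (Function.eval j)
      (Measure.infinitePi fun _ : ℕ => ν) ν := fun j =>
    measurePreserving_eval_infinitePi (fun _ : ℕ => ν) j
  have hint : Integrable φ ν := (integrable_const (1 : ℝ)).indicator (measurableSet_singleton i)
  have h := strong_law_ae_real (μ := Measure.infinitePi fun _ : ℕ => ν)
    (fun j ω => φ (ω j)) ((hev 0).integrable_comp_of_integrable hint)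
    (fun j k hjk => (iIndepFun_infinitePi (P := fun _ : ℕ => ν) (X := fun _ => φ)
      fun _ => hφm).indepFun hjk)
    (fun j => ((IdentDistrib.mk (hev j).measurable.aemeasurable (hev 0).measurable.aemeasurable
      ((hev j).map_eq.trans (hev 0).map_eq.symm)).comp hφm))
  have hE : ∫ ω, φ (ω 0) ∂(Measure.infinitePi fun _ : ℕ => ν) = p i := by
    have h1 : ∫ ω, φ (Function.eval 0 ω) ∂(Measure.infinitePi fun _ : ℕ => ν) = ∫ x, φ x ∂ν := by
      conv_rhs => rw [← (hev 0).map_eq]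
      rw [integral_map (hev 0).measurable.aemeasurable
        hφm.aestronglyMeasurable]
    refine h1.trans ?_
    rw [hφ, integral_indicator_one (measurableSet_singleton i), measureReal_def, hν,
      ENNReal.toReal_ofReal (hp0 i)]
  filter_upwards [h] with ω hω
  rw [hE] at hω
  refine hω.congr fun N => ?_
  congr 1
  rw [digitCount, Finset.card_filter]
  push_cast
  refine Finset.sum_congr rfl fun j _ => ?_
  simp only [hφ, Set.indicator_apply, Set.mem_singleton_iff, Fin.ext_iff, Pi.one_apply,
    coe_digitsOf, Nat.add_right_cancel_iff]

lemma infinitePi_cylinder_eq {n : ℕ} {p : Fin n → ℝ} (hp0 : ∀ i, 0 ≤ p i) (ν : Measure (Fin n))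
    [IsProbabilityMeasure ν] (hν : ∀ i, ν {i} = ENNReal.ofReal (p i)) (ω : ℕ → Fin n) (N : ℕ) :
    Measure.infinitePi (fun _ : ℕ => ν) {ω' | ∀ j < N, ω' j = ω j} =
      ENNReal.ofReal (∏ j ∈ Finset.range N, p (ω j)) := by
  have h1 : {ω' : ℕ → Fin n | ∀ j < N, ω' j = ω j} =
      Set.pi (Finset.range N) fun j => {ω j} := by
    ext ω'
    simp [Set.mem_pi]
  rw [h1, Measure.infinitePi_pi _ fun j _ => measurableSet_singleton _,
    ENNReal.ofReal_prod_of_nonneg fun j _ => hp0 _]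
  exact Finset.prod_congr rfl fun j _ => hν _

/-- Along a sequence with frequencies `p`, cylinder masses are bounded by a power of the
cylinder lengths. -/
lemma exists_prod_le {α : ℝ} (hα : 1 < α) {n : ℕ} {p : Fin n → ℝ} (hp0 : ∀ i, 0 ≤ p i)
    (hp : ∑ i, p i = 1) {t : ℝ}
    (ht : t * (expectedValue p * Real.log α - Real.log (α - 1)) < entropy p) (ω : ℕ → Fin n)
    (hω : ∀ i : Fin n, HasFrequency (digitsOf ω) ((i : ℕ) + 1) (p i)) :
    ∃ m : ℕ, ∀ N, ∏ j ∈ Finset.range N, p (ω j) ≤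
      m * (∏ j ∈ Finset.range N, ratio α (digitsOf ω j)) ^ t := by
  -- The mean of `g` under `p` is tD - H < 0, so its partial sums along `ω` are bounded above.
  set g : Fin n → ℝ := fun i => Real.log (p i) - t * Real.log (ratio α ((i : ℕ) + 1)) with hg
  have hlim : ∑ i, p i * g i < 0 := by
    have : ∀ i, p i * g i = p i * Real.log (p i) -
        t * (p i * Real.log (ratio α ((i : ℕ) + 1))) := fun i => by rw [hg]; ring
    simp only [this, Finset.sum_sub_distrib, ← Finset.mul_sum, sum_mul_log_ratio hα hp]
    rw [entropy] at ht
    linarith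
  have hsum : ∀ N, ∑ j ∈ Finset.range N, extendDigits g 0 (digitsOf ω j) =
      ∑ j ∈ Finset.range N, g (ω j) := fun N => Finset.sum_congr rfl fun j _ => by
    rw [coe_digitsOf, extendDigits_succ]
  obtain ⟨M, hM⟩ := eventually_atTop.1 (((tendsto_average hp hω g 0).eventually
    (gt_mem_nhds hlim)).and (eventually_gt_atTop 0))
  have hbd : ∃ C : ℝ, ∀ N, ∑ j ∈ Finset.range N, g (ω j) ≤ C := by
    obtain ⟨C, hC⟩ := ((Finset.range M).image
      fun N => ∑ j ∈ Finset.range N, g (ω j)).bddAbove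
    refine ⟨max C 0, fun N => ?_⟩
    rcases lt_or_ge N M with hN | hN
    · exact le_max_of_le_left (hC (Finset.mem_coe.2
        (Finset.mem_image_of_mem _ (Finset.mem_range.2 hN))))
    · obtain ⟨h1, h2⟩ := hM N hN
      rw [hsum, div_lt_iff₀ (by positivity), zero_mul] at h1
      exact le_max_of_le_right h1.le
  obtain ⟨C, hC⟩ := hbd
  obtain ⟨m, hm⟩ := exists_nat_ge (Real.exp C)
  refine ⟨m, fun N => ?_⟩
  have hr : ∀ j, 0 < ratio α (digitsOf ω j) := fun j => ratio_pos hα _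
  have hrN := prod_ratio_pos hα N (digitsOf ω)
  calc ∏ j ∈ Finset.range N, p (ω j)
      ≤ ∏ j ∈ Finset.range N, (Real.exp (g (ω j)) * ratio α (digitsOf ω j) ^ t) := by
        refine Finset.prod_le_prod (fun j _ => hp0 _) fun j _ => ?_
        rw [Real.rpow_def_of_pos (hr j), ← Real.exp_add, coe_digitsOf, hg]
        ring_nf
        -- An inequality, not an equality: when p = 0, `Real.log 0 = 0` gives exp(log p) = 1.
        exact Real.le_exp_log _
    _ = Real.exp (∑ j ∈ Finset.range N, g (ω j)) *
          (∏ j ∈ Finset.range N, ratio α (digitsOf ω j)) ^ t := by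
        rw [Finset.prod_mul_distrib, Real.exp_sum, Real.finsetProd_rpow _ _ fun j _ => (hr j).le]
    _ ≤ _ := by
        gcongr
        exact (Real.exp_le_exp.2 (hC N)).trans hm

/-- A set of sequences along which cylinder masses are controlled has measure controlled by
the diameter of its image. -/
lemma measure_le_of_dist_le {α : ℝ} (hα : 1 < α) {n : ℕ} (P : Measure (ℕ → Fin n)) {C t : ℝ}
    (hC : 0 ≤ C) (ht : 0 < t) {B : Set (ℕ → Fin n)}
    (hB : ∀ ω ∈ B, ∀ N, P {ω' | ∀ j < N, ω' j = ω j} ≤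
      ENNReal.ofReal (C * (∏ j ∈ Finset.range N, ratio α (digitsOf ω j)) ^ t))
    {a : ℝ} (ha : 0 < a)
    (hdist : ∀ ω ∈ B, ∀ ω' ∈ B, |value α (digitsOf ω) - value α (digitsOf ω')| < a) :
    P B ≤ ENNReal.ofReal (C * (a / (ratio α n / α ^ n)) ^ t) := by
  rcases B.eq_empty_or_nonempty with rfl | ⟨ω, hω⟩
  · simp
  have hc : 0 < ratio α n / α ^ n := div_pos (ratio_pos hα n) (by positivity)
  set c := ratio α n / α ^ n
  set r := fun N => ∏ j ∈ Finset.range N, ratio α (digitsOf ω j)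
  have hr0 : ∀ N, 0 < r N := fun N => prod_ratio_pos hα N _
  -- At every earlier level separation exceeds the spread of `B`, so `B` lies in the single cylinder
  -- whose level is the least such `N`.
  have hex : ∃ N, c * r N < a := by
    have h1 : Tendsto (fun N : ℕ => c * ratio α 1 ^ N) atTop (𝓝 0) := by
      simpa using (tendsto_pow_atTop_nhds_zero_of_lt_one (ratio_pos hα 1).le
        (ratio_one_lt_one hα)).const_mul c
    obtain ⟨N, hN⟩ := (h1.eventually (gt_mem_nhds ha)).exists
    exact ⟨N, (mul_le_mul_of_nonneg_left (prod_ratio_le hα N _) hc.le).trans_lt hN⟩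
  classical
  have hsub : B ⊆ {ω' | ∀ j < Nat.find hex, ω' j = ω j} := by
    intro ω' hω' j
    induction j using Nat.strong_induction_on with
    | _ j ih =>
      intro hj
      by_contra hne
      have h1 := le_abs_value_sub_value hα j (digitsOf ω) (digitsOf ω') (digitsOf_le ω)
        (digitsOf_le ω') (fun i hi => by rw [digitsOf, digitsOf, ih i hi (hi.trans hj)])
        (digitsOf_ne (Ne.symm hne))
      exact Nat.find_min hex hj (h1.trans_lt (hdist ω hω ω' hω'))
  refine (measure_mono hsub).trans ((hB ω hω _).trans (ENNReal.ofReal_le_ofReal ?_))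
  have h2 : r (Nat.find hex) ≤ a / c := by
    rw [le_div_iff₀ hc, mul_comm]
    exact (Nat.find_spec hex).le
  exact mul_le_mul_of_nonneg_left (Real.rpow_le_rpow (hr0 _).le h2 ht.le) hC

/-- The mass distribution principle. -/
lemma hausdorffMeasure_ne_zero_of_measure_le {X : Type*} [EMetricSpace X] [MeasurableSpace X]
    [BorelSpace X] {μ : Measure X} {K : ℝ≥0∞} (hK0 : K ≠ 0) (hK : K ≠ ∞) {t : ℝ}
    (h : ∀ s : Set X, μ s ≤ K * Metric.ediam s ^ t) {F : Set X} (hF : μ F ≠ 0) : μH[t] F ≠ 0 := by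
  have h1 : K⁻¹ • μ ≤ μH[t] := Measure.le_hausdorffMeasure t _ 1 one_pos fun s _ => by
    rw [Measure.smul_apply, smul_eq_mul, ENNReal.inv_mul_le_iff hK0 hK]
    exact h s
  refine fun h0 => ?_
  have h2 := h1 F
  rw [h0, Measure.smul_apply, smul_eq_mul, nonpos_iff_eq_zero, mul_eq_zero] at h2
  exact h2.elim (ENNReal.inv_ne_zero.2 hK) hF

/-- The ball condition of the mass distribution principle. Passing to the closure keeps the diameter
and supplies measurability. -/
lemma map_restrict_le {α : ℝ} (hα : 1 < α) {n : ℕ} (P : Measure (ℕ → Fin n)) {C t : ℝ}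
    (hC : 0 < C) (ht : 0 < t) {A : Set (ℕ → Fin n)}
    (hA : ∀ ω ∈ A, ∀ N, P {ω' | ∀ j < N, ω' j = ω j} ≤
      ENNReal.ofReal (C * (∏ j ∈ Finset.range N, ratio α (digitsOf ω j)) ^ t)) (s : Set ℝ) :
    (P.restrict A).map (fun ω => value α (digitsOf ω)) s ≤
      ENNReal.ofReal (C / (ratio α n / α ^ n) ^ t) * Metric.ediam s ^ t := by
  have hc : 0 < ratio α n / α ^ n := div_pos (ratio_pos hα n) (by positivity)
  have hm := measurable_value_digitsOf hα n
  refine (measure_mono subset_closure).trans ?_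
  rw [← Metric.ediam_closure s, Measure.map_apply hm isClosed_closure.measurableSet,
    Measure.restrict_apply (hm isClosed_closure.measurableSet)]
  rcases eq_or_ne (Metric.ediam (closure s)) ∞ with htop | htop
  · have h0 : ENNReal.ofReal (C / (ratio α n / α ^ n) ^ t) ≠ 0 := by
      rw [Ne, ENNReal.ofReal_eq_zero, not_le]
      positivity
    rw [htop, ENNReal.top_rpow_of_pos ht, ENNReal.mul_top h0]
    exact le_top
  set a := Metric.diam (closure s) with ha
  have ha0 : 0 ≤ a := Metric.diam_nonneg
  -- The estimate needs a strict, positive bound on distances, so it is applied with every b > a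
  -- before letting b tend to a; this also covers diameter zero.
  have hlim : Tendsto (fun b : ℝ => ENNReal.ofReal (C * (b / (ratio α n / α ^ n)) ^ t)) (𝓝[>] a)
      (𝓝 (ENNReal.ofReal (C * (a / (ratio α n / α ^ n)) ^ t))) := by
    refine Tendsto.mono_left ?_ nhdsWithin_le_nhds
    refine ENNReal.tendsto_ofReal (Tendsto.const_mul _ ?_)
    exact (tendsto_id.div_const _).rpow_const (Or.inr ht.le)
  have hle := ge_of_tendsto hlim (b := P ((fun ω => value α (digitsOf ω)) ⁻¹' closure s ∩ A)) ?_
  · refine hle.trans_eq ?_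
    rw [← ENNReal.ofReal_toReal htop, ENNReal.ofReal_rpow_of_nonneg ENNReal.toReal_nonneg ht.le,
      ← ENNReal.ofReal_mul (by positivity), Real.div_rpow ha0 hc.le]
    congr 1
    rw [ha, Metric.diam]
    ring
  · filter_upwards [self_mem_nhdsWithin] with b hb
    refine measure_le_of_dist_le hα P hC.le ht (fun ω hω => hA ω hω.2) (ha0.trans_lt hb) ?_
    intro ω hω ω' hω'
    rw [← Real.dist_eq]
    exact (Metric.dist_le_diam_of_mem (Metric.isBounded_iff_ediam_ne_top.2 htop)
      hω.1 hω'.1).trans_lt hb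

lemma exists_measure_of_sum_eq_one {n : ℕ} {p : Fin n → ℝ} (hp0 : ∀ i, 0 ≤ p i)
    (hp : ∑ i, p i = 1) : ∃ ν : Measure (Fin n), IsProbabilityMeasure ν ∧
      ∀ i, ν {i} = ENNReal.ofReal (p i) := by
  refine ⟨(PMF.ofFintype (fun i => ENNReal.ofReal (p i)) ?_).toMeasure, inferInstance,
    fun i => ?_⟩
  · rw [← ENNReal.ofReal_sum_of_nonneg fun i _ => hp0 i, hp, ENNReal.ofReal_one]
  · rw [PMF.toMeasure_apply_singleton _ _ (measurableSet_singleton i), PMF.ofFintype_apply]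

lemma hausdorffMeasure_frequencySet_ne_zero {α : ℝ} (hα : 1 < α) {n : ℕ} {p : Fin n → ℝ}
    (hp0 : ∀ i, 0 ≤ p i) (hp : ∑ i, p i = 1) {t : ℝ} (ht0 : 0 < t)
    (ht : t * (expectedValue p * Real.log α - Real.log (α - 1)) < entropy p) :
    μH[t] (frequencySet α p) ≠ 0 := by
  obtain ⟨ν, _, hν⟩ := exists_measure_of_sum_eq_one hp0 hp
  set P := Measure.infinitePi fun _ : ℕ => ν
  have hc : 0 < ratio α n / α ^ n := div_pos (ratio_pos hα n) (by positivity)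
  set G : Set (ℕ → Fin n) :=
    {ω | ∀ i : Fin n, HasFrequency (digitsOf ω) ((i : ℕ) + 1) (p i)} with hG
  set A : ℕ → Set (ℕ → Fin n) := fun m => {ω | ∀ N, P {ω' | ∀ j < N, ω' j = ω j} ≤
    ENNReal.ofReal ((m + 1 : ℝ) *
      (∏ j ∈ Finset.range N, ratio α (digitsOf ω j)) ^ t)}
  have hGA : G ⊆ ⋃ m, G ∩ A m := by
    intro ω hω
    obtain ⟨m, hm⟩ := exists_prod_le hα hp0 hp ht ω hω
    refine Set.mem_iUnion.2 ⟨m, hω, fun N => ?_⟩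
    rw [infinitePi_cylinder_eq hp0 ν hν]
    refine ENNReal.ofReal_le_ofReal ((hm N).trans ?_)
    have := Real.rpow_nonneg (prod_ratio_pos hα N (digitsOf ω)).le t
    gcongr
    linarith
  -- The constant in the mass bound varies with the sequence; some level set `A m` on which it is
  -- uniform still meets `G` in positive measure.
  obtain ⟨m, hm⟩ : ∃ m, P (G ∩ A m) ≠ 0 := by
    by_contra! h
    have h1 : P G = 0 := measure_mono_null hGA (measure_iUnion_null h)
    have h2 : ∀ᵐ ω ∂P, ω ∈ G := ae_hasFrequency hp0 ν hν
    rw [measure_eq_zero_iff_ae_notMem] at h1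
    obtain ⟨ω, h3, h4⟩ := (h1.and h2).exists
    exact h3 h4
  have hm1 : (0 : ℝ) < m + 1 := by positivity
  refine hausdorffMeasure_ne_zero_of_measure_le (K := ENNReal.ofReal
    ((m + 1 : ℝ) / (ratio α n / α ^ n) ^ t)) ?_ ENNReal.ofReal_ne_top
    (map_restrict_le hα P hm1 ht0 (A := A m) fun ω hω => hω) ?_
  · rw [Ne, ENNReal.ofReal_eq_zero, not_le]
    positivity
  · refine fun h0 => hm (le_antisymm ?_ zero_le)
    -- Both the restriction and the image measure are used through inequalities valid for arbitrary
    -- sets, so `G`, `A m` and the frequency set need not be shown measurable.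
    calc P (G ∩ A m) ≤ P.restrict (A m) G := Measure.le_restrict_apply _ _
      _ ≤ P.restrict (A m) ((fun ω => value α (digitsOf ω)) ⁻¹' frequencySet α p) :=
          measure_mono fun ω hω => ⟨⟨value_pos hα _, value_le_one hα _⟩, digitsOf ω,
            isExpansion_value hα _, hω⟩
      _ ≤ _ := Measure.le_map_apply (measurable_value_digitsOf hα n).aemeasurable _
      _ = 0 := h0

lemma le_dimH_frequencySet {α : ℝ} (hα : 1 < α) {n : ℕ} {p : Fin n → ℝ} (hp0 : ∀ i, 0 ≤ p i)
    (hp : ∑ i, p i = 1) :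
    ENNReal.ofReal (entropy p / (expectedValue p * Real.log α - Real.log (α - 1))) ≤
      dimH (frequencySet α p) := by
  have hL := lyapunov_pos hα hp0 hp
  refine ENNReal.le_of_forall_nnreal_lt fun t ht => ?_
  rcases eq_or_ne t 0 with rfl | ht0
  · simp
  have ht' : (t : ℝ) < entropy p / (expectedValue p * Real.log α - Real.log (α - 1)) := by
    rw [← ENNReal.ofReal_coe_nnreal] at ht
    exact (ENNReal.ofReal_lt_ofReal_iff_of_nonneg t.coe_nonneg).1 ht
  rw [lt_div_iff₀ hL] at ht'
  exact le_dimH_of_hausdorffMeasure_ne_zero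
    (hausdorffMeasure_frequencySet_ne_zero hα hp0 hp (NNReal.coe_pos.2 (pos_iff_ne_zero.2 ht0))
      ht')

end

end AlphaExpansion

theorem theorem4p2 (α : ℝ) (hα : 1 < α) (n : ℕ) (p : Fin n → ℝ)
    (hp_nonneg : ∀ i, 0 ≤ p i) (hp_sum : ∑ i, p i = 1) :
    dimH (AlphaExpansion.frequencySet α p) =
      ENNReal.ofReal (AlphaExpansion.entropy p /
        (AlphaExpansion.expectedValue p * Real.log α - Real.log (α - 1))) :=
  le_antisymm (AlphaExpansion.dimH_frequencySet_le hα hp_nonneg hp_sum)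
    (AlphaExpansion.le_dimH_frequencySet hα hp_nonneg hp_sum)
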